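/- Let $n\in\mathbb N$, let $A_{-1}\in\mathbb C^{n\times n}$, and let $A_2,A_3$ be $n\times n$ matrix functions on $[-1,0]$ with entries in $L_2([-1,0],\mathbb C)$. Put $$\Delta(\lambda)=-\lambda I+\lambda e^{-\lambda}A_{-1}+\lambda\int_{-1}^0 e^{\lambda s}A_2(s)\,ds+\int_{-1}^0 e^{\lambda s}A_3(s)\,ds,\qquad \lambda\in\mathbb C,$$ let $\Delta'=\frac{d}{d\lambda}\Delta$, and let $\Delta^*(\lambda)$ be given by the same formula with $A_{-1},A_2(s),A_3(s)$ replaced by their adjoints $A_{-1}^*,A_2^*(s),A_3^*(s)$. (The roots of $\det\Delta(\lambda)=0$ are the eigenvalues of the operator associated with the delay system $\dot z(t)=A_{-1}\dot z(t-1)+\int_{-1}^0A_2(\theta)\dot z(t+\theta)\,d\theta+\int_{-1}^0A_3(\theta)z(t+\theta)\,d\theta$.) Let $\sigma_1=\{\mu_1,\dots,\mu_{\ell_1}\}$ be the set of eigenvalues of $A_{-1}$ with $|\mu|=1$, and suppose that each of them is simple (has algebraic multiplicity one). For $m=1,\dots,\ell_1$ and $k\in\mathbb Z$ let $\widetilde\lambda_m^k=\ln|\mu_m|+i(\arg\mu_m+2\pi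 k)$. Let $(r^{(k)})_{k\in\mathbb Z}$ be real numbers with $\sum_{k\in\mathbb Z}(r^{(k)})^2<\infty$, and write $\lambda_m^k$ for any root of $\det\Delta(\lambda)=0$ in the disc $|\lambda-\widetilde\lambda_m^k|\le r^{(k)}$. Then there exist constants $0<C_1<C_2$ and $N\in\mathbb N$ such that for all $m=1,\dots,\ell_1$, all $k\in\mathbb Z$ with $|k|\ge N$, all such $\lambda_m^k$, and all unit vectors $x_m^k\in\operatorname{Ker}\Delta(\lambda_m^k)$ and $y_m^k\in\operatorname{Ker}\Delta^*(\overline{\lambda_m^k})$ (Euclidean norm and inner product of $\mathbb C^n$), $$C_1\le\left|\frac1{\lambda_m^k}\left\langle\Delta'(\lambda_m^k)x_m^k,\,y_m^k\right\rangle\right|\le C_2 .$$ -/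

import Mathlib

open MeasureTheory

noncomputable section

namespace NeutralDelay

variable {n : ℕ}

/-- The characteristic matrix `Δ(z) = -z I + z e^{-z} A + z ∫_{-1}^0 e^{zs} A₂(s) ds
+ ∫_{-1}^0 e^{zs} A₃(s) ds` of the neutral delay system with neutral term `A = A₋₁`;
the integrals of matrices are taken entry by entry. -/
def charDelta (A : Matrix (Fin n) (Fin n) ℂ) (A₂ A₃ : ℝ → Matrix (Fin n) (Fin n) ℂ) (z : ℂ) :
    Matrix (Fin n) (Fin n) ℂ :=
  -(z • (1 : Matrix (Fin n) (Fin n) ℂ)) + (z * Complex.exp (-z)) • A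
    + z • Matrix.of (fun i j => ∫ s in (-1 : ℝ)..0, Complex.exp (z * (s : ℂ)) * A₂ s i j)
    + Matrix.of (fun i j => ∫ s in (-1 : ℝ)..0, Complex.exp (z * (s : ℂ)) * A₃ s i j)

/-- The matrix function `Δ*`, given by the same formula for the adjoint matrices
`A*`, `A₂(s)*`, `A₃(s)*`. -/
def charDeltaStar (A : Matrix (Fin n) (Fin n) ℂ) (A₂ A₃ : ℝ → Matrix (Fin n) (Fin n) ℂ) (z : ℂ) :
    Matrix (Fin n) (Fin n) ℂ :=
  charDelta A.conjTranspose (fun s => (A₂ s).conjTranspose) (fun s => (A₃ s).conjTranspose) z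

/-- The derivative `Δ'(z) = dΔ/dz`, entry by entry. -/
def charDeltaDeriv (A : Matrix (Fin n) (Fin n) ℂ) (A₂ A₃ : ℝ → Matrix (Fin n) (Fin n) ℂ) (z : ℂ) :
    Matrix (Fin n) (Fin n) ℂ :=
  Matrix.of (fun i j => deriv (fun w : ℂ => charDelta A A₂ A₃ w i j) z)

/-- `σ₁`, the set of the eigenvalues of `A` on the unit circle. -/
def unitSpectrum (A : Matrix (Fin n) (Fin n) ℂ) : Set ℂ :=
  {μ | μ ∈ spectrum ℂ A ∧ ‖μ‖ = 1}

/-- The unperturbed eigenvalue `ln |μ| + i (arg μ + 2πk)`. -/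
def unperturbed (μ : ℂ) (k : ℤ) : ℂ :=
  (Real.log ‖μ‖ : ℂ) + Complex.I * ((Complex.arg μ : ℂ) + 2 * (Real.pi : ℂ) * (k : ℂ))

/-- The eigenvalues of the system labelled by `μ ∈ σ₁` and `k`: the roots of `det Δ = 0` in the
disc of radius `r k` about the unperturbed eigenvalue. -/
def labelledEigenvalues (A : Matrix (Fin n) (Fin n) ℂ) (A₂ A₃ : ℝ → Matrix (Fin n) (Fin n) ℂ)
    (r : ℤ → ℝ) (μ : ℂ) (k : ℤ) : Set ℂ :=
  {z | (charDelta A A₂ A₃ z).det = 0 ∧ z ∈ Metric.closedBall (unperturbed μ k) (r k)}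

end NeutralDelay

end

/-!
Let `μ ≠ 0` be a simple eigenvalue of `A`. As `z` runs through points near the logarithms of `μ` of
large index, `e^z → μ` while `|Im z| → ∞`, so by the Riemann–Lebesgue lemma, uniform for `Re z` in a
bounded set, the integral terms vanish in the limit: `Δ(z) / z → T := -1 + μ⁻¹ A` and
`Δ'(z) / z → B := -μ⁻¹ A`. For `x ∈ Ker T` and `y ∈ Ker T*` the pairing `⟪B x, y⟫` is `-⟪x, y⟫`, and
left and right eigenvectors of a simple eigenvalue are not orthogonal. Hence
`|⟪B x, y⟫| + ‖T x‖ + ‖T* y‖` has a positive minimum over all unit vectors `x`, `y`, and by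
compactness this lower bound survives small perturbations of `T` and `B`, although the kernels may
jump. There are only finitely many such `μ`.
-/

namespace NeutralDelay

open Filter Topology Complex
open scoped InnerProductSpace Matrix

section FiniteLaplace

variable {E : Type*} [NormedAddCommGroup E] {a b : ℝ} {f : ℝ → E}

lemma intervalIntegrable_of_memLp_Icc {p : ENNReal} (hab : a ≤ b) (hp : 1 ≤ p)
    (hf : MemLp f p (volume.restrict (Set.Icc a b))) :
    IntervalIntegrable f volume a b :=
  (intervalIntegrable_iff_integrableOn_Icc_of_le hab).mpr (hf.integrable hp)

variable [NormedSpace ℂ E]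

/-- The finite Laplace transform of `f` over the interval from `a` to `b`, with the sign convention
`e^{zs}` of the characteristic matrix. -/
noncomputable def finiteLaplace (a b : ℝ) (f : ℝ → E) (z : ℂ) : E :=
  ∫ s in a..b, exp (z * s) • f s

lemma intervalIntegrable_cexp_mul_smul (hf : IntervalIntegrable f volume a b) (z : ℂ) :
    IntervalIntegrable (fun s : ℝ => exp (z * s) • f s) volume a b :=
  hf.continuousOn_smul (by fun_prop)

lemma intervalIntegrable_ofReal_smul (hf : IntervalIntegrable f volume a b) :
    IntervalIntegrable (fun s : ℝ => (s : ℂ) • f s) volume a b :=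
  hf.continuousOn_smul (by fun_prop)

lemma abs_le_max_abs_of_mem_uIoc {s : ℝ} (hs : s ∈ Set.uIoc a b) : |s| ≤ max |a| |b| := by
  have hs' := Set.uIoc_subset_uIcc hs
  rw [Set.mem_uIcc] at hs'
  rcases hs' with h | h
  · exact abs_le_max_abs_abs h.1 h.2
  · rw [max_comm]
    exact abs_le_max_abs_abs h.1 h.2

lemma hasDerivAt_finiteLaplace (hf : IntervalIntegrable f volume a b) (z : ℂ) :
    HasDerivAt (finiteLaplace a b f) (finiteLaplace a b (fun s => (s : ℂ) • f s) z) z := by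
  have hsf := intervalIntegrable_ofReal_smul hf
  refine (intervalIntegral.hasDerivAt_integral_of_dominated_loc_of_deriv_le
    (F := fun w s => exp (w * s) • f s) (F' := fun w s => exp (w * s) • (s : ℂ) • f s)
    (bound := fun s => Real.exp ((‖z‖ + 1) * max |a| |b|) * ‖(s : ℂ) • f s‖)
    (Metric.ball_mem_nhds z one_pos)
    (Eventually.of_forall fun w =>
      (intervalIntegrable_cexp_mul_smul hf w).aestronglyMeasurable_restrict_uIoc)
    (intervalIntegrable_cexp_mul_smul hf z)
    (intervalIntegrable_cexp_mul_smul hsf z).aestronglyMeasurable_restrict_uIoc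
    ?_ (hsf.norm.const_mul _) ?_).2
  · refine Eventually.of_forall fun s hs w hw => ?_
    have hw' : ‖w‖ ≤ ‖z‖ + 1 := by
      rw [mem_ball_iff_norm] at hw
      linarith [norm_le_norm_add_norm_sub' w z]
    have hre : (w * s).re ≤ (‖z‖ + 1) * max |a| |b| :=
      calc (w * s).re ≤ ‖w * s‖ := re_le_norm _
        _ = ‖w‖ * |s| := by rw [norm_mul, norm_real, Real.norm_eq_abs]
        _ ≤ (‖z‖ + 1) * max |a| |b| := by
          gcongr
          exact abs_le_max_abs_of_mem_uIoc hs
    rw [norm_smul, norm_exp]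
    gcongr
  · refine Eventually.of_forall fun s _ w _ => ?_
    simpa [mul_smul] using ((hasDerivAt_id w).mul_const (s : ℂ)).cexp.smul_const (f s)

lemma norm_finiteLaplace_sub_le (hf : IntervalIntegrable f volume a b) {z w : ℂ}
    (hzw : ‖z - w‖ * max |a| |b| ≤ 1) :
    ‖finiteLaplace a b f z - finiteLaplace a b f w‖ ≤
      ‖z - w‖ * |∫ s in a..b, Real.exp (|w.re| * max |a| |b|) * (2 * max |a| |b|) * ‖f s‖| := by
  rw [finiteLaplace, finiteLaplace,
    ← intervalIntegral.integral_sub (intervalIntegrable_cexp_mul_smul hf z)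
      (intervalIntegrable_cexp_mul_smul hf w),
    ← abs_of_nonneg (norm_nonneg (z - w)), ← abs_mul, ← intervalIntegral.integral_const_mul]
  refine intervalIntegral.norm_integral_le_abs_of_norm_le ?_ ((hf.norm.const_mul _).const_mul _)
  refine (ae_restrict_mem measurableSet_uIoc).mono fun s hs => ?_
  have hsM := abs_le_max_abs_of_mem_uIoc hs
  have hsmall : ‖(z - w) * s‖ ≤ ‖z - w‖ * max |a| |b| := by
    rw [norm_mul, norm_real, Real.norm_eq_abs]
    gcongr
  have hexp : ‖exp (w * s)‖ ≤ Real.exp (|w.re| * max |a| |b|) := by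
    rw [norm_exp, re_mul_ofReal]
    refine Real.exp_le_exp.mpr ((le_abs_self _).trans ?_)
    rw [abs_mul]
    gcongr
  have hsub : ‖exp ((z - w) * s) - 1‖ ≤ 2 * (‖z - w‖ * max |a| |b|) :=
    (norm_exp_sub_one_le (hsmall.trans hzw)).trans (by gcongr)
  calc ‖exp (z * s) • f s - exp (w * s) • f s‖
      = ‖exp (w * s)‖ * ‖exp ((z - w) * s) - 1‖ * ‖f s‖ := by
        rw [← sub_smul, norm_smul, ← norm_mul, mul_sub, ← exp_add, mul_one]
        ring_nf
    _ ≤ Real.exp (|w.re| * max |a| |b|) * (2 * (‖z - w‖ * max |a| |b|)) * ‖f s‖ := by gcongr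
    _ = ‖z - w‖ * (Real.exp (|w.re| * max |a| |b|) * (2 * max |a| |b|) * ‖f s‖) := by ring

lemma tendsto_finiteLaplace_verticalLine (a b : ℝ) (f : ℝ → E) (σ : ℝ) :
    Tendsto (fun t : ℝ => finiteLaplace a b f (σ + t * I)) (cocompact ℝ) (𝓝 0) := by
  let g : ℝ → E := (Set.uIoc a b).indicator fun s => exp (σ * s) • f s
  have hscale : Tendsto (fun t : ℝ => t * (-(2 * Real.pi)⁻¹)) (cocompact ℝ) (cocompact ℝ) :=
    (Homeomorph.mulRight₀ (-(2 * Real.pi)⁻¹)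
      (by simp [Real.pi_ne_zero])).isClosedEmbedding.tendsto_cocompact
  have hRL := ((Real.tendsto_integral_exp_smul_cocompact g).comp hscale).const_smul
    (if a ≤ b then 1 else -1 : ℝ)
  rw [smul_zero] at hRL
  refine hRL.congr fun t => ?_
  rw [finiteLaplace, intervalIntegral.intervalIntegral_eq_integral_uIoc,
    ← integral_indicator measurableSet_uIoc]
  congr 1
  refine integral_congr_ae (Eventually.of_forall fun s => ?_)
  by_cases hs : s ∈ Set.uIoc a b
  · simp only [g, hs, Set.indicator_of_mem, Circle.smul_def, Real.fourierChar_apply, smul_smul,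
      ← exp_add]
    congr 2
    push_cast
    field_simp
    ring
  · simp [g, hs]

lemma tendsto_finiteLaplace (hf : IntervalIntegrable f volume a b) {l : Filter ℂ} {σ : ℝ}
    (hre : Tendsto re l (𝓝 σ)) (him : Tendsto im l (cocompact ℝ)) :
    Tendsto (finiteLaplace a b f) l (𝓝 0) := by
  have hline := (tendsto_finiteLaplace_verticalLine a b f σ).comp him
  have hdist : Tendsto (fun z : ℂ => ‖z - (σ + z.im * I)‖) l (𝓝 0) := by
    refine (tendsto_iff_norm_sub_tendsto_zero.mp hre).congr fun z => ?_
    rw [← norm_real]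
    congr 1
    apply Complex.ext <;> simp
  have hsub : Tendsto (fun z : ℂ => finiteLaplace a b f z - finiteLaplace a b f (σ + z.im * I)) l
      (𝓝 0) := by
    have hbound := hdist.mul_const
      (|∫ s in a..b, Real.exp (|σ| * max |a| |b|) * (2 * max |a| |b|) * ‖f s‖|)
    rw [zero_mul] at hbound
    refine squeeze_zero_norm' ?_ hbound
    have hsmall := hdist.mul_const (max |a| |b|)
    rw [zero_mul] at hsmall
    filter_upwards [hsmall.eventually_le_const one_pos] with z hz
    simpa using norm_finiteLaplace_sub_le hf hz
  simpa using hsub.add hline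

lemma finiteLaplace_conj (a b : ℝ) (f : ℝ → ℂ) (z : ℂ) :
    finiteLaplace a b (fun s => star (f s)) (starRingEnd ℂ z) = star (finiteLaplace a b f z) := by
  simp only [finiteLaplace, star_def, ← intervalIntegral.intervalIntegral_conj, smul_eq_mul,
    map_mul, ← exp_conj, conj_ofReal]

end FiniteLaplace

section FarLogs

variable {μ : ℂ}

/-- The filter of points `z` with `|Im z| → ∞` and `e^z → μ`, that is, of neighbourhoods of the
logarithms of `μ` of large index. -/
noncomputable def farLogFilter (μ : ℂ) : Filter ℂ :=
  comap im (cocompact ℝ) ⊓ comap exp (𝓝 μ)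

lemma tendsto_im_farLogFilter (μ : ℂ) : Tendsto im (farLogFilter μ) (cocompact ℝ) :=
  tendsto_comap.mono_left inf_le_left

lemma tendsto_exp_farLogFilter (μ : ℂ) : Tendsto exp (farLogFilter μ) (𝓝 μ) :=
  tendsto_comap.mono_left inf_le_right

lemma tendsto_exp_neg_farLogFilter (hμ : μ ≠ 0) :
    Tendsto (fun z => exp (-z)) (farLogFilter μ) (𝓝 μ⁻¹) :=
  ((tendsto_exp_farLogFilter μ).inv₀ hμ).congr fun z => (exp_neg z).symm

lemma tendsto_re_farLogFilter (hμ : μ ≠ 0) :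
    Tendsto re (farLogFilter μ) (𝓝 (Real.log ‖μ‖)) :=
  ((tendsto_exp_farLogFilter μ).norm.log (norm_ne_zero_iff.mpr hμ)).congr fun z => by
    rw [norm_exp, Real.log_exp]

lemma tendsto_cobounded_farLogFilter (μ : ℂ) :
    Tendsto id (farLogFilter μ) (Bornology.cobounded ℂ) := by
  rw [← tendsto_norm_atTop_iff_cobounded]
  exact tendsto_atTop_mono abs_im_le_norm
    (tendsto_norm_cocompact_atTop.comp (tendsto_im_farLogFilter μ))

lemma tendsto_inv_farLogFilter (μ : ℂ) : Tendsto (fun z => z⁻¹) (farLogFilter μ) (𝓝 0) :=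
  tendsto_inv₀_cobounded.comp (tendsto_cobounded_farLogFilter μ)

lemma eventually_ne_zero_farLogFilter (μ : ℂ) : ∀ᶠ z in farLogFilter μ, z ≠ 0 :=
  (tendsto_cobounded_farLogFilter μ).eventually_ne_cobounded 0

lemma exp_unperturbed (hμ : μ ≠ 0) (k : ℤ) : exp (unperturbed μ k) = μ := by
  have h : unperturbed μ k = log μ + k * (2 * Real.pi * I) := by
    simp only [unperturbed, log]
    ring
  rw [h, exp_add, exp_int_mul_two_pi_mul_I, mul_one, exp_log hμ]

lemma im_unperturbed (μ : ℂ) (k : ℤ) : (unperturbed μ k).im = arg μ + 2 * Real.pi * k := by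
  simp [unperturbed]

lemma tendsto_unperturbed_add (hμ : μ ≠ 0) :
    Tendsto (fun q : ℤ × ℂ => unperturbed μ q.1 + q.2) (cofinite ×ˢ 𝓝 0) (farLogFilter μ) := by
  refine tendsto_inf.mpr ⟨tendsto_comap_iff.mpr ?_, tendsto_comap_iff.mpr ?_⟩
  · have hk : Tendsto (fun q : ℤ × ℂ => ‖2 * Real.pi * (q.1 : ℝ)‖) (cofinite ×ˢ 𝓝 0) atTop := by
      simp only [norm_mul]
      exact (tendsto_norm_cocompact_atTop.comp
        (Int.tendsto_coe_cofinite.comp tendsto_fst)).const_mul_atTop (by simp)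
    have hw : Tendsto (fun q : ℤ × ℂ => ‖arg μ + q.2.im‖) (cofinite ×ˢ 𝓝 0)
        (𝓝 ‖arg μ + (0 : ℂ).im‖) :=
      (((continuous_im.tendsto 0).comp tendsto_snd).const_add _).norm
    rw [← Metric.cobounded_eq_cocompact, ← tendsto_norm_atTop_iff_cobounded]
    refine tendsto_atTop_mono (fun q => ?_) (hk.atTop_add hw.neg)
    have him : (unperturbed μ q.1 + q.2).im = 2 * Real.pi * q.1 + (arg μ + q.2.im) := by
      rw [add_im, im_unperturbed]
      ring
    rw [Function.comp_apply, him, ← sub_eq_add_neg, sub_le_iff_le_add,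
      add_comm (2 * Real.pi * (q.1 : ℝ))]
    exact norm_le_add_norm_add' _ _
  · have hexp : Tendsto (fun q : ℤ × ℂ => μ * exp q.2) (cofinite ×ˢ 𝓝 0) (𝓝 (μ * exp 0)) :=
      (tendsto_snd.cexp).const_mul μ
    rw [exp_zero, mul_one] at hexp
    refine hexp.congr fun q => ?_
    rw [Function.comp_apply, exp_add, exp_unperturbed hμ]

lemma eventually_forall_mem_closedBall_unperturbed (hμ : μ ≠ 0) {r : ℤ → ℝ}
    (hr : Tendsto r cofinite (𝓝 0)) {p : ℂ → Prop} (hp : ∀ᶠ z in farLogFilter μ, p z) :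
    ∀ᶠ k in cofinite, ∀ z ∈ Metric.closedBall (unperturbed μ k) (r k), p z := by
  obtain ⟨pk, hpk, pw, hpw, h⟩ :=
    eventually_prod_iff.mp ((tendsto_unperturbed_add hμ).eventually hp)
  obtain ⟨ε, hε, hball⟩ := Metric.eventually_nhds_iff.mp hpw
  filter_upwards [hpk, hr.eventually_lt_const hε] with k hk hrk z hz
  have hw : pw (z - unperturbed μ k) :=
    hball (by rw [dist_zero_right, ← dist_eq_norm]; exact hz.trans_lt hrk)
  simpa using h hk hw

end FarLogs

section CharDelta

variable {m n : Type*} {a b : ℝ}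

/-- The finite Laplace transform of a matrix function, taken entry by entry. -/
noncomputable def matrixLaplace (a b : ℝ) (F : ℝ → Matrix m n ℂ) (z : ℂ) : Matrix m n ℂ :=
  .of fun i j => finiteLaplace a b (fun s => F s i j) z

lemma tendsto_matrixLaplace {F : ℝ → Matrix m n ℂ}
    (hF : ∀ i j, IntervalIntegrable (fun s => F s i j) volume a b) {l : Filter ℂ} {σ : ℝ}
    (hre : Tendsto re l (𝓝 σ)) (him : Tendsto im l (cocompact ℝ)) :
    Tendsto (matrixLaplace a b F) l (𝓝 0) :=
  tendsto_pi_nhds.mpr fun i => tendsto_pi_nhds.mpr fun j => tendsto_finiteLaplace (hF i j) hre him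

lemma matrixLaplace_conjTranspose (a b : ℝ) (F : ℝ → Matrix m n ℂ) (z : ℂ) :
    matrixLaplace a b (fun s => (F s)ᴴ) (starRingEnd ℂ z) = (matrixLaplace a b F z)ᴴ := by
  ext i j
  exact finiteLaplace_conj a b _ z

variable {d : ℕ} {A : Matrix (Fin d) (Fin d) ℂ} {A₂ A₃ : ℝ → Matrix (Fin d) (Fin d) ℂ} {μ : ℂ}

lemma charDelta_eq (A : Matrix (Fin d) (Fin d) ℂ) (A₂ A₃ : ℝ → Matrix (Fin d) (Fin d) ℂ) (z : ℂ) :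
    charDelta A A₂ A₃ z =
      z • (-1 + exp (-z) • A + matrixLaplace (-1) 0 A₂ z) + matrixLaplace (-1) 0 A₃ z := by
  rw [smul_add, smul_add, smul_neg, smul_smul]
  rfl

lemma charDeltaStar_conj (A : Matrix (Fin d) (Fin d) ℂ)
    (A₂ A₃ : ℝ → Matrix (Fin d) (Fin d) ℂ) (z : ℂ) :
    charDeltaStar A A₂ A₃ (starRingEnd ℂ z) = (charDelta A A₂ A₃ z)ᴴ := by
  simp only [charDeltaStar, charDelta_eq, matrixLaplace_conjTranspose, Matrix.conjTranspose_add,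
    Matrix.conjTranspose_smul, Matrix.conjTranspose_neg, Matrix.conjTranspose_one, star_def,
    ← exp_conj, map_neg]

lemma charDeltaDeriv_eq (hA₂ : ∀ i j, IntervalIntegrable (fun s => A₂ s i j) volume (-1) 0)
    (hA₃ : ∀ i j, IntervalIntegrable (fun s => A₃ s i j) volume (-1) 0) (z : ℂ) :
    charDeltaDeriv A A₂ A₃ z =
      z • (-(exp (-z) • A) + matrixLaplace (-1) 0 (fun s => (s : ℂ) • A₂ s) z)
        + (-1 + exp (-z) • A + matrixLaplace (-1) 0 A₂ z
          + matrixLaplace (-1) 0 (fun s => (s : ℂ) • A₃ s) z) := by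
  ext i j
  have hbracket : HasDerivAt
      (fun w => (-1 : Matrix (Fin d) (Fin d) ℂ) i j + exp (-w) * A i j
        + finiteLaplace (-1) 0 (fun s => A₂ s i j) w)
      (exp (-z) * (-1) * A i j + finiteLaplace (-1) 0 (fun s => (s : ℂ) • A₂ s i j) z) z :=
    (((hasDerivAt_neg z).cexp.mul_const _).const_add _).add (hasDerivAt_finiteLaplace (hA₂ i j) z)
  have hderiv := ((hasDerivAt_id z).mul hbracket).add (hasDerivAt_finiteLaplace (hA₃ i j) z)
  simp only [charDeltaDeriv, charDelta_eq, Matrix.of_apply]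
  refine (HasDerivAt.deriv hderiv).trans ?_
  simp only [matrixLaplace, Matrix.add_apply, Matrix.smul_apply, Matrix.neg_apply,
    Matrix.of_apply, smul_eq_mul, id]
  ring

lemma tendsto_inv_smul_charDelta (hμ : μ ≠ 0)
    (hA₂ : ∀ i j, IntervalIntegrable (fun s => A₂ s i j) volume (-1) 0)
    (hA₃ : ∀ i j, IntervalIntegrable (fun s => A₃ s i j) volume (-1) 0) :
    Tendsto (fun z => z⁻¹ • charDelta A A₂ A₃ z) (farLogFilter μ) (𝓝 (-1 + μ⁻¹ • A)) := by
  have hre := tendsto_re_farLogFilter hμ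
  have him := tendsto_im_farLogFilter μ
  have hlim := ((((tendsto_exp_neg_farLogFilter hμ).smul_const A).const_add (-1)).add
    (tendsto_matrixLaplace hA₂ hre him)).add
      ((tendsto_inv_farLogFilter μ).smul (tendsto_matrixLaplace hA₃ hre him))
  rw [smul_zero, add_zero, add_zero] at hlim
  refine hlim.congr' ?_
  filter_upwards [eventually_ne_zero_farLogFilter μ] with z hz
  rw [charDelta_eq, smul_add, inv_smul_smul₀ hz]

lemma tendsto_inv_smul_charDeltaDeriv (hμ : μ ≠ 0)
    (hA₂ : ∀ i j, IntervalIntegrable (fun s => A₂ s i j) volume (-1) 0)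
    (hA₃ : ∀ i j, IntervalIntegrable (fun s => A₃ s i j) volume (-1) 0) :
    Tendsto (fun z => z⁻¹ • charDeltaDeriv A A₂ A₃ z) (farLogFilter μ) (𝓝 (-(μ⁻¹ • A))) := by
  have hre := tendsto_re_farLogFilter hμ
  have him := tendsto_im_farLogFilter μ
  have hexpA := (tendsto_exp_neg_farLogFilter hμ).smul_const A
  have hlim := (hexpA.neg.add
    (tendsto_matrixLaplace (F := fun s => (s : ℂ) • A₂ s)
      (fun i j => intervalIntegrable_ofReal_smul (hA₂ i j)) hre him)).add
      ((tendsto_inv_farLogFilter μ).smul (((hexpA.const_add (-1)).add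
        (tendsto_matrixLaplace hA₂ hre him)).add
          (tendsto_matrixLaplace (F := fun s => (s : ℂ) • A₃ s)
            (fun i j => intervalIntegrable_ofReal_smul (hA₃ i j)) hre him)))
  rw [zero_smul, add_zero, add_zero] at hlim
  refine hlim.congr' ?_
  filter_upwards [eventually_ne_zero_farLogFilter μ] with z hz
  rw [charDeltaDeriv_eq hA₂ hA₃, smul_add z⁻¹ (z • _), inv_smul_smul₀ hz]

end CharDelta

section KerPairing

variable {𝕜 ι : Type*} [RCLike 𝕜] [Fintype ι] [DecidableEq ι] {T B : Matrix ι ι 𝕜} {c C : ℝ}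

/-- The modulus of the form `⟪B x, y⟫` (linear in `x`) lies between `c` and `C` for all unit vectors
`x` in the kernel of `T` and `y` in the kernel of its adjoint. -/
def KerPairingBounds (T B : Matrix ι ι 𝕜) (c C : ℝ) : Prop :=
  ∀ x ∈ LinearMap.ker T.toEuclideanLin, ∀ y ∈ LinearMap.ker Tᴴ.toEuclideanLin,
    ‖x‖ = 1 → ‖y‖ = 1 → ‖⟪y, B.toEuclideanLin x⟫_𝕜‖ ∈ Set.Icc c C

lemma KerPairingBounds.mem_Icc_of_smul {a : 𝕜} (h : KerPairingBounds (a • T) (a • B) c C)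
    {x y : EuclideanSpace 𝕜 ι} (hx : x ∈ LinearMap.ker T.toEuclideanLin)
    (hy : y ∈ LinearMap.ker Tᴴ.toEuclideanLin) (hx₁ : ‖x‖ = 1) (hy₁ : ‖y‖ = 1) :
    ‖a * ⟪y, B.toEuclideanLin x⟫_𝕜‖ ∈ Set.Icc c C := by
  rw [LinearMap.mem_ker] at hx hy
  have hbounds := h x (by simp [hx]) y (by simp [Matrix.conjTranspose_smul, hy]) hx₁ hy₁
  rwa [map_smul, LinearMap.smul_apply, inner_smul_right] at hbounds

lemma continuous_toEuclideanLin_apply {X : Type*} [TopologicalSpace X] {M : X → Matrix ι ι 𝕜}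
    {x : X → EuclideanSpace 𝕜 ι} (hM : Continuous M) (hx : Continuous x) :
    Continuous fun q => (M q).toEuclideanLin (x q) :=
  (PiLp.continuous_toLp 2 _).comp (hM.matrix_mulVec ((PiLp.continuous_ofLp 2 _).comp hx))

lemma continuous_inner_toEuclideanLin_apply {X : Type*} [TopologicalSpace X]
    {M : X → Matrix ι ι 𝕜} {x y : X → EuclideanSpace 𝕜 ι} (hM : Continuous M)
    (hx : Continuous x) (hy : Continuous y) :
    Continuous fun q => ⟪y q, (M q).toEuclideanLin (x q)⟫_𝕜 :=
  hy.inner (continuous_toEuclideanLin_apply hM hx)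

lemma eventually_norm_inner_le (B : Matrix ι ι 𝕜) :
    ∀ᶠ C in atTop, ∀ᶠ M in 𝓝 B, ∀ x y : EuclideanSpace 𝕜 ι, ‖x‖ = 1 → ‖y‖ = 1 →
      ‖⟪y, M.toEuclideanLin x⟫_𝕜‖ ≤ C := by
  have hcont : Continuous fun q : Matrix ι ι 𝕜 × EuclideanSpace 𝕜 ι × EuclideanSpace 𝕜 ι =>
      ‖⟪q.2.2, q.1.toEuclideanLin q.2.1⟫_𝕜‖ :=
    (continuous_inner_toEuclideanLin_apply continuous_fst continuous_snd.fst
      continuous_snd.snd).norm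
  have hS := isCompact_sphere (0 : EuclideanSpace 𝕜 ι) 1
  obtain ⟨C₀, hC₀⟩ := (hS.prod hS).bddAbove_image
    (hcont.comp (Continuous.prodMk_right B)).continuousOn
  filter_upwards [eventually_gt_atTop C₀] with C hC
  have hnear := (hS.prod hS).eventually_forall_of_forall_eventually (x₀ := B)
    (P := fun M p => ‖⟪p.2, M.toEuclideanLin p.1⟫_𝕜‖ < C) fun p hp =>
    hcont.continuousAt.eventually_lt_const ((hC₀ (Set.mem_image_of_mem _ hp)).trans_lt hC)
  filter_upwards [hnear] with M hM x y hx hy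
  exact (hM (x, y) ⟨by simpa using hx, by simpa using hy⟩).le

lemma eventually_le_norm_inner_of_ker
    (h : ∀ x ∈ LinearMap.ker T.toEuclideanLin, ∀ y ∈ LinearMap.ker Tᴴ.toEuclideanLin,
      x ≠ 0 → y ≠ 0 → ⟪y, B.toEuclideanLin x⟫_𝕜 ≠ 0) :
    ∀ᶠ c in 𝓝[>] (0 : ℝ), ∀ᶠ Q in 𝓝 (T, B),
      ∀ x ∈ LinearMap.ker Q.1.toEuclideanLin, ∀ y ∈ LinearMap.ker Q.1ᴴ.toEuclideanLin,
        ‖x‖ = 1 → ‖y‖ = 1 → c ≤ ‖⟪y, Q.2.toEuclideanLin x⟫_𝕜‖ := by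
  -- The last two norms vanish on the kernels and keep `G` positive off them.
  let G : (Matrix ι ι 𝕜 × Matrix ι ι 𝕜) × EuclideanSpace 𝕜 ι × EuclideanSpace 𝕜 ι → ℝ := fun q =>
    ‖⟪q.2.2, q.1.2.toEuclideanLin q.2.1⟫_𝕜‖ + ‖q.1.1.toEuclideanLin q.2.1‖
      + ‖q.1.1ᴴ.toEuclideanLin q.2.2‖
  have hG : Continuous G :=
    ((continuous_inner_toEuclideanLin_apply (by fun_prop) (by fun_prop) (by fun_prop)).norm.add
      (continuous_toEuclideanLin_apply (by fun_prop) (by fun_prop)).norm).add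
      (continuous_toEuclideanLin_apply (by fun_prop) (by fun_prop)).norm
  have hS := isCompact_sphere (0 : EuclideanSpace 𝕜 ι) 1
  have hpos : ∀ p ∈ Metric.sphere (0 : EuclideanSpace 𝕜 ι) 1 ×ˢ Metric.sphere 0 1,
      0 < G ((T, B), p) := by
    rintro ⟨x, y⟩ ⟨hx, hy⟩
    by_cases hTx : T.toEuclideanLin x = 0
    · by_cases hTy : Tᴴ.toEuclideanLin y = 0
      · have := norm_pos_iff.mpr (h x hTx y hTy (ne_zero_of_mem_unit_sphere ⟨x, hx⟩)
          (ne_zero_of_mem_unit_sphere ⟨y, hy⟩))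
        positivity
      · have := norm_pos_iff.mpr hTy
        positivity
    · have := norm_pos_iff.mpr hTx
      positivity
  obtain ⟨c₀, hc₀, hc₀G⟩ := (hS.prod hS).exists_forall_le'
    (hG.comp (Continuous.prodMk_right (T, B))).continuousOn hpos
  filter_upwards [Ioo_mem_nhdsGT hc₀] with c hc
  have hnear := (hS.prod hS).eventually_forall_of_forall_eventually (x₀ := (T, B))
    (P := fun Q p => c < G (Q, p)) fun p hp =>
    hG.continuousAt.eventually_const_lt (hc.2.trans_le (hc₀G p hp))
  filter_upwards [hnear] with Q hQ x hx y hy hx₁ hy₁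
  rw [LinearMap.mem_ker] at hx hy
  simpa [G, hx, hy] using (hQ (x, y) ⟨by simpa using hx₁, by simpa using hy₁⟩).le

lemma eventually_kerPairingBounds
    (h : ∀ x ∈ LinearMap.ker T.toEuclideanLin, ∀ y ∈ LinearMap.ker Tᴴ.toEuclideanLin,
      x ≠ 0 → y ≠ 0 → ⟪y, B.toEuclideanLin x⟫_𝕜 ≠ 0) :
    ∀ᶠ c in 𝓝[>] (0 : ℝ), ∀ᶠ C in atTop, ∀ᶠ Q in 𝓝 (T, B), KerPairingBounds Q.1 Q.2 c C := by
  filter_upwards [eventually_le_norm_inner_of_ker h] with c hc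
  filter_upwards [eventually_norm_inner_le B] with C hC
  filter_upwards [hc, continuousAt_snd.eventually hC] with Q hcQ hCQ x hx y hy hx₁ hy₁
  exact ⟨hcQ x hx y hy hx₁ hy₁, hCQ x y hx₁ hy₁⟩

end KerPairing

section SimpleEigenvalue

/-- The Fitting decomposition of `φ - μ` splits `V` into the eigenline and a subspace of the range
of `φ - μ`; a functional vanishing on both summands is zero. -/
lemma apply_ne_zero_of_rootMultiplicity_charpoly_eq_one {K V : Type*} [Field K] [AddCommGroup V]
    [Module K V] [FiniteDimensional K V] {φ : Module.End K V} {μ : K}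
    (hμ : φ.charpoly.rootMultiplicity μ = 1) {x : V} (hx : x ≠ 0) (hφx : φ x = μ • x)
    {ℓ : Module.Dual K V} (hℓ : ℓ ≠ 0) (hφℓ : ∀ v, ℓ (φ v) = μ * ℓ v) : ℓ x ≠ 0 := by
  intro hℓx
  let ψ : Module.End K V := φ - μ • 1
  have hline : φ.maxGenEigenspace μ = K ∙ x := by
    refine (Submodule.eq_of_le_of_finrank_eq ?_ ?_).symm
    · rw [Submodule.span_singleton_le_iff_mem, Module.End.mem_maxGenEigenspace]
      exact ⟨1, by simp [hφx]⟩
    · rw [LinearMap.finrank_maxGenEigenspace_eq, hμ, finrank_span_singleton hx]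
  have hker : ⨆ k, LinearMap.ker (ψ ^ k) ≤ LinearMap.ker ℓ := by
    refine iSup_le fun k v hv => ?_
    have hv' : v ∈ φ.maxGenEigenspace μ := (Module.End.mem_maxGenEigenspace φ μ v).mpr ⟨k, hv⟩
    rw [hline] at hv'
    exact (Submodule.span_singleton_le_iff_mem x _).mpr hℓx hv'
  have hrange : ⨅ k, LinearMap.range (ψ ^ k) ≤ LinearMap.ker ℓ := by
    refine (iInf_le _ 1).trans ?_
    rintro _ ⟨v, rfl⟩
    simp [ψ, hφℓ]
  have hfitting := ψ.isCompl_iSup_ker_pow_iInf_range_pow.sup_eq_top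
  exact hℓ (LinearMap.ker_eq_top.mp (top_le_iff.mp (hfitting ▸ sup_le hker hrange)))

variable {𝕜 : Type*} [RCLike 𝕜] {μ : 𝕜}

lemma inner_ne_zero_of_rootMultiplicity_charpoly_eq_one {V : Type*} [NormedAddCommGroup V]
    [InnerProductSpace 𝕜 V] [FiniteDimensional 𝕜 V] {φ : Module.End 𝕜 V}
    (hμ : φ.charpoly.rootMultiplicity μ = 1) {x y : V} (hx : x ≠ 0) (hφx : φ x = μ • x)
    (hy : y ≠ 0) (hφy : φ.adjoint y = starRingEnd 𝕜 μ • y) : ⟪y, x⟫_𝕜 ≠ 0 := by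
  refine apply_ne_zero_of_rootMultiplicity_charpoly_eq_one hμ hx hφx (ℓ := innerₛₗ 𝕜 y) ?_ ?_
  · intro h
    exact hy (inner_self_eq_zero.mp (LinearMap.congr_fun h y))
  · intro v
    rw [innerₛₗ_apply_apply, innerₛₗ_apply_apply, ← LinearMap.adjoint_inner_left, hφy,
      inner_smul_left, RCLike.conj_conj]

lemma inner_ne_zero_of_mem_ker_neg_one_add {ι : Type*} [Fintype ι] [DecidableEq ι]
    {A : Matrix ι ι 𝕜} (hμ : A.charpoly.rootMultiplicity μ = 1) (hμ₀ : μ ≠ 0)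
    {x y : EuclideanSpace 𝕜 ι} (hx : x ∈ LinearMap.ker (-1 + μ⁻¹ • A).toEuclideanLin)
    (hy : y ∈ LinearMap.ker (-1 + μ⁻¹ • A)ᴴ.toEuclideanLin) (hx₀ : x ≠ 0) (hy₀ : y ≠ 0) :
    ⟪y, (-(μ⁻¹ • A)).toEuclideanLin x⟫_𝕜 ≠ 0 := by
  have hcharpoly : A.toEuclideanLin.charpoly = A.charpoly := by
    rw [Matrix.toEuclideanLin, Matrix.toLpLin_eq_toLin, Matrix.charpoly_toLin]
  have hone : (1 : Matrix ι ι 𝕜).toEuclideanLin = 1 := by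
    ext; simp
  have hAx : μ⁻¹ • A.toEuclideanLin x = x :=
    (neg_add_eq_zero.mp (by simpa [hone] using hx)).symm
  have hAy : (starRingEnd 𝕜 μ)⁻¹ • A.toEuclideanLin.adjoint y = y :=
    (neg_add_eq_zero.mp (by simpa [hone, Matrix.conjTranspose_smul,
      Matrix.toEuclideanLin_conjTranspose_eq_adjoint] using hy)).symm
  have hinner : ⟪y, x⟫_𝕜 ≠ 0 := by
    refine inner_ne_zero_of_rootMultiplicity_charpoly_eq_one (φ := A.toEuclideanLin) (μ := μ)
      (by rw [hcharpoly, hμ]) hx₀ ?_ hy₀ ?_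
    · rwa [inv_smul_eq_iff₀ hμ₀] at hAx
    · rwa [inv_smul_eq_iff₀ ((map_ne_zero _).mpr hμ₀)] at hAy
  rwa [map_neg, map_smul, LinearMap.neg_apply, LinearMap.smul_apply, hAx, inner_neg_right,
    neg_ne_zero]

end SimpleEigenvalue

lemma finite_setOf_rootMultiplicity_eq_one {R : Type*} [CommRing R] [IsDomain R]
    (p : Polynomial R) : {μ : R | p.rootMultiplicity μ = 1}.Finite := by
  classical
  refine p.roots.toFinset.finite_toSet.subset fun μ (hμ : p.rootMultiplicity μ = 1) => ?_
  rw [Finset.mem_coe, Multiset.mem_toFinset, ← Multiset.count_pos, Polynomial.count_roots, hμ]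
  exact one_pos

lemma exists_forall_le_abs_of_eventually_cofinite {p : ℤ → Prop} (h : ∀ᶠ k in cofinite, p k) :
    ∃ N : ℕ, ∀ k : ℤ, (N : ℤ) ≤ |k| → p k := by
  rw [Int.cofinite_eq, ← comap_abs_atTop, eventually_comap, eventually_atTop] at h
  obtain ⟨M, hM⟩ := h
  exact ⟨M.toNat, fun k hk => hM |k| ((Int.self_le_toNat M).trans hk) k rfl⟩

lemma tendsto_zero_of_summable_sq {α : Type*} {r : α → ℝ} (hr : Summable fun k => r k ^ 2) :
    Tendsto r cofinite (𝓝 0) := by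
  have h := hr.tendsto_cofinite_zero.sqrt
  simp only [Real.sqrt_sq_eq_abs, Real.sqrt_zero] at h
  exact (tendsto_zero_iff_abs_tendsto_zero r).mpr h

section CharDeltaPairing

variable {d : ℕ} {A : Matrix (Fin d) (Fin d) ℂ} {A₂ A₃ : ℝ → Matrix (Fin d) (Fin d) ℂ} {μ : ℂ}

lemma eventually_kerPairingBounds_charDelta (hμ₀ : μ ≠ 0)
    (hμ : A.charpoly.rootMultiplicity μ = 1)
    (hA₂ : ∀ i j, IntervalIntegrable (fun s => A₂ s i j) volume (-1) 0)
    (hA₃ : ∀ i j, IntervalIntegrable (fun s => A₃ s i j) volume (-1) 0) :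
    ∀ᶠ c in 𝓝[>] (0 : ℝ), ∀ᶠ C in atTop, ∀ᶠ z in farLogFilter μ,
      KerPairingBounds (z⁻¹ • charDelta A A₂ A₃ z) (z⁻¹ • charDeltaDeriv A A₂ A₃ z) c C := by
  have hlim := (tendsto_inv_smul_charDelta (A := A) hμ₀ hA₂ hA₃).prodMk_nhds
    (tendsto_inv_smul_charDeltaDeriv (A := A) hμ₀ hA₂ hA₃)
  filter_upwards [eventually_kerPairingBounds fun x hx y hy =>
    inner_ne_zero_of_mem_ker_neg_one_add hμ hμ₀ hx hy] with c hc
  filter_upwards [hc] with C hC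
  exact hlim.eventually hC

end CharDeltaPairing

end NeutralDelay

open Filter Topology NeutralDelay in
theorem mainTheorem8_general {n : ℕ} {A : Matrix (Fin n) (Fin n) ℂ}
    {A₂ A₃ : ℝ → Matrix (Fin n) (Fin n) ℂ}
    (hA₂ : ∀ i j, IntervalIntegrable (fun s => A₂ s i j) volume (-1) 0)
    (hA₃ : ∀ i j, IntervalIntegrable (fun s => A₃ s i j) volume (-1) 0)
    {r : ℤ → ℝ} (hr : Tendsto r cofinite (𝓝 0)) :
    ∃ (C₁ C₂ : ℝ) (N : ℕ), 0 < C₁ ∧ C₁ < C₂ ∧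
      ∀ μ : ℂ, μ ≠ 0 → A.charpoly.rootMultiplicity μ = 1 → ∀ k : ℤ, (N : ℤ) ≤ |k| →
        ∀ z ∈ Metric.closedBall (unperturbed μ k) (r k),
          ∀ x ∈ LinearMap.ker (Matrix.toEuclideanLin (charDelta A A₂ A₃ z)),
          ∀ y ∈ LinearMap.ker (Matrix.toEuclideanLin
              (charDeltaStar A A₂ A₃ (starRingEnd ℂ z))),
            ‖x‖ = 1 → ‖y‖ = 1 →
              ‖(1 / z) * inner ℂ y (Matrix.toEuclideanLin (charDeltaDeriv A A₂ A₃ z) x)‖ ∈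
                Set.Icc C₁ C₂ := by
  have hfin : {μ : ℂ | μ ≠ 0 ∧ A.charpoly.rootMultiplicity μ = 1}.Finite :=
    (finite_setOf_rootMultiplicity_eq_one A.charpoly).subset fun μ hμ => hμ.2
  have hbounds : ∀ᶠ c in 𝓝[>] (0 : ℝ), ∀ᶠ C in atTop, ∀ᶠ k in cofinite,
      ∀ μ ∈ {μ : ℂ | μ ≠ 0 ∧ A.charpoly.rootMultiplicity μ = 1},
        ∀ z ∈ Metric.closedBall (unperturbed μ k) (r k),
          KerPairingBounds (z⁻¹ • charDelta A A₂ A₃ z) (z⁻¹ • charDeltaDeriv A A₂ A₃ z) c C := by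
    simp only [eventually_all_finite hfin]
    intro μ hμ
    filter_upwards [eventually_kerPairingBounds_charDelta hμ.1 hμ.2 hA₂ hA₃] with c hc
    filter_upwards [hc] with C hC
    exact eventually_forall_mem_closedBall_unperturbed hμ.1 hr hC
  obtain ⟨c, hcC, hc⟩ := (hbounds.and self_mem_nhdsWithin).exists
  obtain ⟨C, hCk, hC⟩ := (hcC.and (eventually_gt_atTop c)).exists
  obtain ⟨N, hN⟩ := exists_forall_le_abs_of_eventually_cofinite hCk
  refine ⟨c, C, N, hc, hC, fun μ hμ₀ hμ k hk z hz x hx y hy hx₁ hy₁ => ?_⟩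
  rw [charDeltaStar_conj] at hy
  rw [one_div]
  exact (hN k hk μ ⟨hμ₀, hμ⟩ z hz).mem_Icc_of_smul hx hy hx₁ hy₁

theorem mainTheorem8 (n : ℕ) (A : Matrix (Fin n) (Fin n) ℂ)
    (A₂ A₃ : ℝ → Matrix (Fin n) (Fin n) ℂ)
    (hA₂ : ∀ i j, MemLp (fun s => A₂ s i j) 2 (volume.restrict (Set.Icc (-1 : ℝ) 0)))
    (hA₃ : ∀ i j, MemLp (fun s => A₃ s i j) 2 (volume.restrict (Set.Icc (-1 : ℝ) 0)))
    (hsimple : ∀ μ ∈ NeutralDelay.unitSpectrum A, A.charpoly.rootMultiplicity μ = 1)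
    (r : ℤ → ℝ) (hr : Summable (fun k => r k ^ 2)) :
    ∃ (C₁ C₂ : ℝ) (N : ℕ), 0 < C₁ ∧ C₁ < C₂ ∧
      ∀ μ ∈ NeutralDelay.unitSpectrum A, ∀ k : ℤ, (N : ℤ) ≤ |k| →
        ∀ z ∈ NeutralDelay.labelledEigenvalues A A₂ A₃ r μ k,
          ∀ x ∈ LinearMap.ker (Matrix.toEuclideanLin (NeutralDelay.charDelta A A₂ A₃ z)),
          ∀ y ∈ LinearMap.ker (Matrix.toEuclideanLin
              (NeutralDelay.charDeltaStar A A₂ A₃ (starRingEnd ℂ z))),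
            ‖x‖ = 1 → ‖y‖ = 1 →
              C₁ ≤ ‖(1 / z) * inner ℂ y
                  (Matrix.toEuclideanLin (NeutralDelay.charDeltaDeriv A A₂ A₃ z) x)‖ ∧
              ‖(1 / z) * inner ℂ y
                  (Matrix.toEuclideanLin (NeutralDelay.charDeltaDeriv A A₂ A₃ z) x)‖ ≤ C₂ := by
  obtain ⟨C₁, C₂, N, hC₁, hC₁₂, hbounds⟩ := mainTheorem8_general (A := A)
    (fun i j => NeutralDelay.intervalIntegrable_of_memLp_Icc (by norm_num) one_le_two (hA₂ i j))
    (fun i j => NeutralDelay.intervalIntegrable_of_memLp_Icc (by norm_num) one_le_two (hA₃ i j))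
    (NeutralDelay.tendsto_zero_of_summable_sq hr)
  exact ⟨C₁, C₂, N, hC₁, hC₁₂, fun μ hμ k hk z hz => hbounds μ
    (norm_ne_zero_iff.mp (hμ.2.trans_ne one_ne_zero)) (hsimple μ hμ) k hk z hz.2⟩
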